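/- There exist absolute constants $\alpha_0>0$ and $c>0$ such that the following holds for all $\alpha\in(0,\alpha_0]$, all positive integers $d,n$, all $\varepsilon\in(0,1]$ and all $\delta\in[0,\frac1{5000n}]$. A sampler for datasets of size $n$ over $\{0,1\}^d$ is a randomized algorithm $\mathcal A$ mapping each $\mathbf x\in(\{0,1\}^d)^n$ to a random element $\mathcal A(\mathbf x)\in\{0,1\}^d$. It is $(\varepsilon,\delta)$-differentially private if $$\Pr[\mathcal A(\mathbf x)\in Y]\le e^{\varepsilon}\Pr[\mathcal A(\mathbf x')\in Y]+\delta$$ for every $Y\subseteq\{0,1\}^d$ and all datasets $\mathbf x,\mathbf x'$ that differ in at most one of their $n$ entries. It is $\alpha$-accurate on the class $\mathcal B^{\otimes d}$ of products of $d$ Bernoulli distributions (with arbitrary biases $p_1,\dots,p_d\in[0,1]$) if for every $P\in\mathcal B^{\otimes d}$ the distribution $Q_{\mathcal A,P}$ of $\mathcal A(\mathbf X)$, where $\mathbf X$ consists of $n$ independent observations from $P$ (independent of the coins of $\mathcal A$), satisfies $d_{TV}(Q_{\mathcal A,P},P)\le\alpha$, where $d_{TV}(Q,P)=\frac12\sum_{z}|Q(z)-P(z)|$.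 If there exists an $(\varepsilon,\delta)$-differentially private sampler for datasets of size $n$ that is $\alpha$-accurate on $\mathcal B^{\otimes d}$, then $$n\ \ge\ c\cdot\frac{d}{\alpha\varepsilon}.$$ -/

import Mathlib

open scoped BigOperators

namespace PrivSampling

noncomputable section

/-- The joint law of independent random variables with laws `P i`, on a finite universe:
its mass at `x` is `∏ i, P i (x i)`. -/
def productPMF {ι U : Type} [Fintype ι] [DecidableEq ι] [Fintype U]
    (P : ι → PMF U) : PMF (ι → U) :=
  PMF.ofFintype (fun x => ∏ i, P i (x i)) (by
    have h : ∀ i, ∑ u, P i u = 1 := fun i => by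
      rw [← tsum_fintype (L := .unconditional U)]; exact (P i).tsum_coe
    rw [← Fintype.prod_sum]
    simp [h])

/-- The probability of an event `S` under `P`, as a real number. -/
def prob {U : Type} (P : PMF U) (S : Set U) : ℝ := (P.toOuterMeasure S).toReal

/-- Total variation distance `½ ‖P - Q‖₁` on a finite universe. -/
def tvDist {U : Type} [Fintype U] (P Q : PMF U) : ℝ :=
  (1 / 2) * ∑ u, |(P u).toReal - (Q u).toReal|

/-- Two datasets of size `n` are neighbors if they differ in at most one entry. -/
def Neighbors {n : ℕ} {U : Type} (x x' : Fin n → U) : Prop :=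
  {i | x i ≠ x' i}.Subsingleton

/-- `(ε, δ)`-differential privacy of a randomized algorithm on datasets of size `n`.
A randomized algorithm maps a dataset to the law of its output. -/
def IsDP {n : ℕ} {U Y : Type} (ε δ : ℝ) (A : (Fin n → U) → PMF Y) : Prop :=
  ∀ x x' : Fin n → U, Neighbors x x' → ∀ S : Set Y,
    prob (A x) S ≤ Real.exp ε * prob (A x') S + δ

/-- The law of `A(X)` where `X` consists of `n` independent observations from `P`. -/
def outputLaw {n : ℕ} {U Y : Type} [Fintype U] (A : (Fin n → U) → PMF Y) (P : PMF U) : PMF Y :=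
  (productPMF fun _ : Fin n => P).bind A

/-- A sampler is `α`-accurate on `P` if its output law on i.i.d. data from `P` is within total
variation distance `α` of `P`. -/
def IsAccurateOn {n : ℕ} {U : Type} [Fintype U] (α : ℝ) (A : (Fin n → U) → PMF U)
    (P : PMF U) : Prop :=
  tvDist (outputLaw A P) P ≤ α

/-- A sampler is `α`-accurate on a class if it is `α`-accurate on each of its members. -/
def IsAccurateOnClass {n : ℕ} {U : Type} [Fintype U] (α : ℝ) (A : (Fin n → U) → PMF U)
    (C : Set (PMF U)) : Prop :=
  ∀ P ∈ C, IsAccurateOn α A P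

/-- The Bernoulli distribution with bias `p ∈ [0,1]`: `true` has mass `p`, `false` mass `1 - p`. -/
def bernoulliPMF (p : Set.Icc (0 : ℝ) 1) : PMF Bool :=
  PMF.ofFintype (fun b => ENNReal.ofReal (if b then p.1 else 1 - p.1)) (by
    have h0 : 0 ≤ p.1 := p.2.1
    have h1 : 0 ≤ 1 - p.1 := sub_nonneg.mpr p.2.2
    simp [← ENNReal.ofReal_add h0 h1])

/-- The class of products of `d` Bernoulli distributions, on `{0,1}^d`. -/
def productBernoulli (d : ℕ) : Set (PMF (Fin d → Bool)) :=
  {P | ∃ p : Fin d → Set.Icc (0 : ℝ) 1, P = productPMF fun j => bernoulliPMF (p j)}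

end

end PrivSampling

namespace PrivSampling

/-! Give each coordinate in a set `S` a small bias `l`, and all others bias `0`. The law puts mass
about `l` on the basis vector `e_j` for `j ∈ S` and none for `j ∉ S`, so an accurate sampler outputs
some `e_j` with `j ∈ S` with probability at least `|S| l (1 - d l) - α`, and one with `j ∉ S` with
probability at most `α`. Adding `j` to `S` changes each data row only with probability `l`. Group
privacy over a binomial number of changed rows (`sum_prod_mixture_le`) raises the probability of
`e_j` by at most a factor `(1 + l (e^ε - 1))^n ≤ e^(2nlε)`, up to a `δ` term. Averaging over all `S`
(`sum_mem_eq_sum_insert`) compares the two bounds; with `l = 10α/d` they conflict unless `n l ε` is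
bounded below, that is, `n ≳ d/(αε)`. -/

/-- Replacing the row law `w` by the mixture `(1 - l) w + l r` in all `n` rows changes the mean of
a function with bounded multiplicative and additive sensitivity by a controlled amount. -/
theorem sum_prod_mixture_le {U : Type} [Fintype U] {w w' r : U → ℝ} {l e δ : ℝ}
    (hw : ∀ u, 0 ≤ w u) (hr : ∀ u, 0 ≤ r u) (hw1 : ∑ u, w u = 1) (hr1 : ∑ u, r u = 1)
    (hmix : ∀ u, w' u = (1 - l) * w u + l * r u) (hl : 0 ≤ l) (hl1 : l ≤ 1)
    (he : 1 ≤ e) (hδ : 0 ≤ δ) (n : ℕ) :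
    ∀ F : (Fin n → U) → ℝ, (∀ x x', Neighbors x x' → F x ≤ e * F x' + δ) →
      ∑ x, (∏ i, w' (x i)) * F x ≤
        (1 + l * (e - 1)) ^ n * (∑ x, (∏ i, w (x i)) * F x + n * (l * δ)) := by
  have ha : 1 ≤ 1 + l * (e - 1) := by nlinarith
  have hw' : ∀ u, 0 ≤ w' u := fun u => by
    rw [hmix]
    exact add_nonneg (mul_nonneg (by linarith) (hw u)) (mul_nonneg hl (hr u))
  have hw'1 : ∑ u, w' u = 1 := by
    simp only [hmix, Finset.sum_add_distrib, ← Finset.mul_sum, hw1, hr1]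
    ring
  induction n with
  | zero => intro F _; simp
  | succ n ih =>
    intro F hF
    have split : ∀ v : U → ℝ, ∑ x : Fin (n + 1) → U, (∏ i, v (x i)) * F x =
        ∑ y : Fin n → U, (∏ i, v (y i)) * ∑ u, v u * F (Fin.cons u y) := fun v => by
      rw [← (Fin.consEquiv fun _ => U).sum_comp, Fintype.sum_prod_type, Finset.sum_comm]
      refine Finset.sum_congr rfl fun y _ => ?_
      rw [Finset.mul_sum]
      refine Finset.sum_congr rfl fun u _ => ?_
      simp only [Fin.consEquiv, Equiv.coe_fn_mk, Fin.prod_univ_succ, Fin.cons_zero, Fin.cons_succ]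
      ring
    -- One row at a time: sensitivity bounds the mean under `r` by that under `w`, and `r` has
    -- weight only `l`.
    have head : ∀ y : Fin n → U, ∑ u, w' u * F (Fin.cons u y) ≤
        (1 + l * (e - 1)) * (∑ u, w u * F (Fin.cons u y)) + l * δ := fun y => by
      have key : ∑ u, r u * F (Fin.cons u y) ≤ e * (∑ v, w v * F (Fin.cons v y)) + δ := by
        have h1 : ∀ u, F (Fin.cons u y) ≤ e * (∑ v, w v * F (Fin.cons v y)) + δ := fun u => by
          have h2 : ∑ v, w v * F (Fin.cons u y) ≤ ∑ v, w v * (e * F (Fin.cons v y) + δ) := by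
            refine Finset.sum_le_sum fun v _ => mul_le_mul_of_nonneg_left (hF _ _ ?_) (hw v)
            intro i hi k hk
            have zero_of : ∀ i : Fin (n + 1),
                i ∈ {i | (Fin.cons u y : Fin (n + 1) → U) i ≠ (Fin.cons v y : _ → U) i} →
                  i = 0 := fun i hi => by
              induction i using Fin.cases with
              | zero => rfl
              | succ i => simp at hi
            rw [zero_of i hi, zero_of k hk]
          rw [← Finset.sum_mul, hw1, one_mul] at h2
          refine h2.trans_eq ?_
          simp only [mul_add, Finset.sum_add_distrib, ← Finset.sum_mul, hw1, one_mul,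
            Finset.mul_sum]
          congr 1
          exact Finset.sum_congr rfl fun v _ => by ring
        calc ∑ u, r u * F (Fin.cons u y)
            ≤ ∑ u, r u * (e * (∑ v, w v * F (Fin.cons v y)) + δ) :=
              Finset.sum_le_sum fun u _ => mul_le_mul_of_nonneg_left (h1 u) (hr u)
          _ = _ := by rw [← Finset.sum_mul, hr1, one_mul]
      have h3 : ∑ u, w' u * F (Fin.cons u y) =
          (1 - l) * (∑ u, w u * F (Fin.cons u y)) + l * ∑ u, r u * F (Fin.cons u y) := by
        rw [Finset.mul_sum, Finset.mul_sum, ← Finset.sum_add_distrib]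
        exact Finset.sum_congr rfl fun u _ => by rw [hmix]; ring
      rw [h3]
      nlinarith [mul_le_mul_of_nonneg_left key hl]
    -- Averaging out the first row preserves the sensitivity bound, so the induction hypothesis
    -- applies to the average.
    have hG : ∀ y y' : Fin n → U, Neighbors y y' →
        ∑ u, w u * F (Fin.cons u y) ≤ e * (∑ u, w u * F (Fin.cons u y')) + δ := fun y y' h => by
      calc ∑ u, w u * F (Fin.cons u y)
          ≤ ∑ u, w u * (e * F (Fin.cons u y') + δ) := by
            refine Finset.sum_le_sum fun u _ => mul_le_mul_of_nonneg_left (hF _ _ ?_) (hw u)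
            intro i hi k hk
            induction i using Fin.cases with
            | zero => simp at hi
            | succ i =>
              induction k using Fin.cases with
              | zero => simp at hk
              | succ k =>
                rw [h (show i ∈ {i | y i ≠ y' i} by simpa using hi)
                  (show k ∈ {i | y i ≠ y' i} by simpa using hk)]
        _ = _ := by
          simp only [mul_add, Finset.sum_add_distrib, ← Finset.sum_mul, hw1, one_mul,
            Finset.mul_sum]
          congr 1
          exact Finset.sum_congr rfl fun v _ => by ring
    have tail := ih _ hG
    have hprod : ∑ y : Fin n → U, ∏ i, w' (y i) = 1 := by
      have := Finset.prod_univ_sum (fun _ : Fin n => (Finset.univ : Finset U)) (fun _ u => w' u)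
      simpa [hw'1] using this.symm
    have hpow : 1 ≤ (1 + l * (e - 1)) ^ (n + 1) := one_le_pow₀ ha
    have hld : 0 ≤ l * δ := mul_nonneg hl hδ
    rw [split, split]
    calc ∑ y : Fin n → U, (∏ i, w' (y i)) * ∑ u, w' u * F (Fin.cons u y)
        ≤ ∑ y : Fin n → U, (∏ i, w' (y i)) *
            ((1 + l * (e - 1)) * (∑ u, w u * F (Fin.cons u y)) + l * δ) :=
          Finset.sum_le_sum fun y _ =>
            mul_le_mul_of_nonneg_left (head y) (Finset.prod_nonneg fun i _ => hw' _)
      _ = (1 + l * (e - 1)) *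
            (∑ y : Fin n → U, (∏ i, w' (y i)) * ∑ u, w u * F (Fin.cons u y)) + l * δ := by
          simp only [mul_add, Finset.sum_add_distrib, ← Finset.sum_mul, hprod, one_mul]
          congr 1
          rw [Finset.mul_sum]
          exact Finset.sum_congr rfl fun v _ => by ring
      _ ≤ (1 + l * (e - 1)) * ((1 + l * (e - 1)) ^ n *
            (∑ y : Fin n → U, (∏ i, w (y i)) * (∑ u, w u * F (Fin.cons u y)) + n * (l * δ)))
            + (1 + l * (e - 1)) ^ (n + 1) * (l * δ) :=
          add_le_add (mul_le_mul_of_nonneg_left tail (by linarith)) (by nlinarith)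
      _ = _ := by push_cast; ring

/-! ### Real-valued masses and total variation -/

theorem PMF_sum_toReal {U : Type} [Fintype U] (P : PMF U) : ∑ u, (P u).toReal = 1 := by
  rw [← ENNReal.toReal_sum fun u _ => P.apply_ne_top u, ← tsum_fintype (L := .unconditional U),
    P.tsum_coe, ENNReal.toReal_one]

theorem sum_le_sum_add_tvDist {U : Type} [Fintype U] [DecidableEq U] (P Q : PMF U)
    (B : Finset U) : ∑ u ∈ B, (P u).toReal ≤ ∑ u ∈ B, (Q u).toReal + tvDist P Q := by
  have hP := PMF_sum_toReal P
  have hQ := PMF_sum_toReal Q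
  rw [← Finset.sum_add_sum_compl B] at hP hQ
  have h1 : ∑ u ∈ B, ((P u).toReal - (Q u).toReal) ≤ ∑ u ∈ B, |(P u).toReal - (Q u).toReal| :=
    Finset.sum_le_sum fun u _ => le_abs_self _
  have h2 : ∑ u ∈ Bᶜ, -((P u).toReal - (Q u).toReal) ≤ ∑ u ∈ Bᶜ, |(P u).toReal - (Q u).toReal| :=
    Finset.sum_le_sum fun u _ => neg_le_abs _
  rw [Finset.sum_sub_distrib] at h1
  rw [Finset.sum_neg_distrib, Finset.sum_sub_distrib] at h2
  rw [tvDist, ← Finset.sum_add_sum_compl B]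
  linarith

theorem sum_le_sum_add_tvDist' {U : Type} [Fintype U] [DecidableEq U] (P Q : PMF U)
    (B : Finset U) : ∑ u ∈ B, (Q u).toReal ≤ ∑ u ∈ B, (P u).toReal + tvDist P Q := by
  have : tvDist P Q = tvDist Q P := by simp only [tvDist, abs_sub_comm]
  rw [this]
  exact sum_le_sum_add_tvDist Q P B

theorem prob_singleton {U : Type} (P : PMF U) (u : U) : prob P {u} = (P u).toReal := by
  rw [prob, PMF.toOuterMeasure_apply_singleton]

theorem productPMF_toReal {ι U : Type} [Fintype ι] [DecidableEq ι] [Fintype U]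
    (P : ι → PMF U) (x : ι → U) : (productPMF P x).toReal = ∏ i, (P i (x i)).toReal := by
  rw [productPMF, PMF.ofFintype_apply, ENNReal.toReal_prod]

theorem outputLaw_toReal {n : ℕ} {U Y : Type} [Fintype U] (A : (Fin n → U) → PMF Y)
    (P : PMF U) (y : Y) :
    (outputLaw A P y).toReal = ∑ x, (∏ i, (P (x i)).toReal) * (A x y).toReal := by
  classical
  rw [outputLaw, PMF.bind_apply, tsum_fintype,
    ENNReal.toReal_sum fun x _ => ENNReal.mul_ne_top (PMF.apply_ne_top _ _) (PMF.apply_ne_top _ _)]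
  exact Finset.sum_congr rfl fun x _ => by rw [ENNReal.toReal_mul, productPMF_toReal]

theorem bernoulliPMF_toReal (p : Set.Icc (0 : ℝ) 1) (b : Bool) :
    (bernoulliPMF p b).toReal = if b then p.1 else 1 - p.1 := by
  rw [bernoulliPMF, PMF.ofFintype_apply, ENNReal.toReal_ofReal]
  split
  · exact p.2.1
  · exact sub_nonneg.mpr p.2.2

/-! ### Sparse product distributions -/

/-- The product of Bernoulli distributions with bias `l` on `S` and bias `0` off `S`. -/
noncomputable def sparseProduct {d : ℕ} (l : Set.Icc (0 : ℝ) 1) (S : Finset (Fin d)) :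
    PMF (Fin d → Bool) :=
  productPMF fun j => bernoulliPMF (if j ∈ S then l else 0)

/-- The `j`-th standard basis vector of `{0,1}^d`. -/
def basisVec {d : ℕ} (j : Fin d) : Fin d → Bool := fun i => decide (i = j)

theorem basisVec_injective {d : ℕ} : Function.Injective (basisVec (d := d)) := fun i j h => by
  have := congrFun h i
  simpa [basisVec] using this

theorem sparseProduct_toReal {d : ℕ} (l : Set.Icc (0 : ℝ) 1) (S : Finset (Fin d))
    (u : Fin d → Bool) : (sparseProduct l S u).toReal =
      ∏ i, if u i then (if i ∈ S then l.1 else 0) else 1 - (if i ∈ S then l.1 else 0) := by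
  rw [sparseProduct, productPMF_toReal]
  refine Finset.prod_congr rfl fun i _ => ?_
  rw [bernoulliPMF_toReal]
  split_ifs <;> rfl

theorem sparseProduct_basisVec_of_notMem {d : ℕ} (l : Set.Icc (0 : ℝ) 1) {S : Finset (Fin d)}
    {j : Fin d} (hj : j ∉ S) : (sparseProduct l S (basisVec j)).toReal = 0 := by
  rw [sparseProduct_toReal]
  exact Finset.prod_eq_zero (Finset.mem_univ j) (by simp [basisVec, hj])

theorem le_sparseProduct_basisVec {d : ℕ} (l : Set.Icc (0 : ℝ) 1) {S : Finset (Fin d)}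
    {j : Fin d} (hj : j ∈ S) :
    l.1 * (1 - d * l.1) ≤ (sparseProduct l S (basisVec j)).toReal := by
  have hl0 := l.2.1
  have hl1 := l.2.2
  rw [sparseProduct_toReal, ← Finset.mul_prod_erase _ _ (Finset.mem_univ j)]
  -- Only `d - 1` other factors occur; exponent `d` is weaker but gives the simple bound `1 - d l`
  -- by Bernoulli's inequality.
  have h1 : (1 - l.1) ^ d ≤ (1 - l.1) ^ (Finset.univ.erase j).card :=
    pow_le_pow_of_le_one (by linarith) (by linarith) (by
      simp)
  have h2 : 1 - d * l.1 ≤ (1 - l.1) ^ d := by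
    have := one_add_mul_le_pow (a := -l.1) (by linarith) d
    rw [← sub_eq_add_neg] at this
    linarith
  have h3 : (1 - l.1) ^ (Finset.univ.erase j).card ≤
      ∏ i ∈ Finset.univ.erase j, if basisVec j i then (if i ∈ S then l.1 else 0)
        else 1 - (if i ∈ S then l.1 else 0) := by
    rw [← Finset.prod_const]
    refine Finset.prod_le_prod (fun _ _ => by linarith) fun i hi => ?_
    have : basisVec j i = false := by simpa [basisVec] using Finset.ne_of_mem_erase hi
    rw [this]
    split_ifs <;> simp_all
  have h4 : (if basisVec j j then (if j ∈ S then l.1 else 0)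
        else 1 - (if j ∈ S then l.1 else 0)) = l.1 := by simp [basisVec, hj]
  rw [h4]
  exact mul_le_mul_of_nonneg_left (h2.trans (h1.trans h3)) hl0

/-- Bias `l` at `j` is the mixture of bias `0` with weight `1 - l` and bias `1` with weight `l`; `R`
fixes coordinate `j` to `true`. -/
theorem sparseProduct_insert {d : ℕ} (l : Set.Icc (0 : ℝ) 1) {S : Finset (Fin d)} {j : Fin d}
    (hj : j ∉ S) : ∃ R : PMF (Fin d → Bool), ∀ u, (sparseProduct l (insert j S) u).toReal =
      (1 - l.1) * (sparseProduct l S u).toReal + l.1 * (R u).toReal := by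
  refine ⟨productPMF fun i => bernoulliPMF (if i = j then 1 else if i ∈ S then l else 0),
    fun u => ?_⟩
  have h : ∀ p : Set.Icc (0 : ℝ) 1,
      (productPMF (fun i => bernoulliPMF (if i = j then p else if i ∈ S then l else 0)) u).toReal =
      (if u j then p.1 else 1 - p.1) *
        ∏ i ∈ Finset.univ.erase j, (bernoulliPMF (if i ∈ S then l else 0) (u i)).toReal := fun p => by
    rw [productPMF_toReal, ← Finset.mul_prod_erase _ _ (Finset.mem_univ j), if_pos rfl,
      bernoulliPMF_toReal]
    congr 1
    exact Finset.prod_congr rfl fun i hi => by rw [if_neg (Finset.ne_of_mem_erase hi)]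
  have hS : sparseProduct l S =
      productPMF fun i => bernoulliPMF (if i = j then 0 else if i ∈ S then l else 0) := by
    rw [sparseProduct]
    congr 1
    funext i
    by_cases hi : i = j
    · subst hi; simp [hj]
    · simp [hi]
  have hI : sparseProduct l (insert j S) =
      productPMF fun i => bernoulliPMF (if i = j then l else if i ∈ S then l else 0) := by
    rw [sparseProduct]
    congr 1
    funext i
    by_cases hi : i = j
    · subst hi; simp
    · simp [hi]
  rw [hS, hI, h, h, h]
  cases u j <;> simp

theorem outputLaw_sparseProduct_insert_le {d n : ℕ} {Y : Type} {ε δ : ℝ} (hε : 0 ≤ ε)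
    (hδ : 0 ≤ δ) {A : (Fin n → (Fin d → Bool)) → PMF Y} (hA : IsDP ε δ A)
    (l : Set.Icc (0 : ℝ) 1) {S : Finset (Fin d)} {j : Fin d} (hj : j ∉ S) (y : Y) :
    (outputLaw A (sparseProduct l (insert j S)) y).toReal ≤
      (1 + l.1 * (Real.exp ε - 1)) ^ n *
        ((outputLaw A (sparseProduct l S) y).toReal + n * (l.1 * δ)) := by
  obtain ⟨R, hR⟩ := sparseProduct_insert l hj
  rw [outputLaw_toReal, outputLaw_toReal]
  refine sum_prod_mixture_le (fun _ => ENNReal.toReal_nonneg) (fun _ => ENNReal.toReal_nonneg)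
    (PMF_sum_toReal _) (PMF_sum_toReal R) hR l.2.1 l.2.2 (Real.one_le_exp hε) hδ n _
    fun x x' hx => ?_
  simpa only [prob_singleton] using hA x x' hx {y}

/-! ### Averaging over supports -/

/-- Erasing `j` from `S` matches pairs with `j ∈ S` to pairs with `j ∉ S`; this pairs each law with
its neighbour lacking `j`. -/
theorem sum_mem_eq_sum_insert {ι : Type} [Fintype ι] [DecidableEq ι] (g : Finset ι → ι → ℝ) :
    ∑ S : Finset ι, ∑ j ∈ S, g S j = ∑ S : Finset ι, ∑ j ∈ Sᶜ, g (insert j S) j := by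
  rw [Finset.sum_sigma', Finset.sum_sigma']
  refine Finset.sum_bij' (fun p _ => ⟨p.1.erase p.2, p.2⟩) (fun p _ => ⟨insert p.2 p.1, p.2⟩)
    ?_ ?_ ?_ ?_ ?_
  · rintro ⟨S, j⟩ h; simp
  · rintro ⟨S, j⟩ h; simp
  · rintro ⟨S, j⟩ h
    have hj : j ∈ S := by simpa using h
    simp [Finset.insert_erase hj]
  · rintro ⟨S, j⟩ h
    have hj : j ∉ S := by simpa using h
    simp [Finset.erase_insert hj]
  · rintro ⟨S, j⟩ h
    have hj : j ∈ S := by simpa using h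
    simp [Finset.insert_erase hj]

theorem sum_card_finset (d : ℕ) :
    (∑ S : Finset (Fin d), (S.card : ℝ)) = d / 2 * 2 ^ d ∧
    (∑ S : Finset (Fin d), (Sᶜ.card : ℝ)) = d / 2 * 2 ^ d := by
  have h1 := sum_mem_eq_sum_insert (ι := Fin d) fun _ _ => 1
  have h2 : ∑ S : Finset (Fin d), ((S.card : ℝ) + Sᶜ.card) = d * 2 ^ d := by
    have : ∀ S : Finset (Fin d), (S.card : ℝ) + Sᶜ.card = d := fun S => by
      exact_mod_cast (Finset.card_add_card_compl S).trans (Fintype.card_fin d)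
    simp [this, mul_comm]
  simp only [Finset.sum_const, nsmul_eq_mul, mul_one] at h1
  rw [Finset.sum_add_distrib] at h2
  constructor <;> linarith

/-- The inequality between the parameters of a private and accurate sampler obtained by averaging
over all supports of the sparse product distributions. -/
theorem sparse_accuracy_privacy_tradeoff {d n : ℕ} {α ε δ : ℝ} (hε : 0 ≤ ε) (hδ : 0 ≤ δ)
    {A : (Fin n → (Fin d → Bool)) → PMF (Fin d → Bool)} (hA : IsDP ε δ A)
    (hacc : IsAccurateOnClass α A (productBernoulli d)) (l : Set.Icc (0 : ℝ) 1) :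
    d / 2 * (l.1 * (1 - d * l.1)) - α ≤
      (1 + l.1 * (Real.exp ε - 1)) ^ n * (α + d / 2 * (n * (l.1 * δ))) := by
  have hmem : ∀ S, sparseProduct l S ∈ productBernoulli d := fun S => ⟨_, rfl⟩
  have hlow : ∀ S : Finset (Fin d), S.card * (l.1 * (1 - d * l.1)) - α ≤
      ∑ j ∈ S, (outputLaw A (sparseProduct l S) (basisVec j)).toReal := fun S => by
    have h := sum_le_sum_add_tvDist' (outputLaw A (sparseProduct l S)) (sparseProduct l S)
      (S.image basisVec)
    rw [Finset.sum_image basisVec_injective.injOn, Finset.sum_image basisVec_injective.injOn] at h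
    have h2 := hacc _ (hmem S)
    rw [IsAccurateOn] at h2
    have h3 := Finset.card_nsmul_le_sum S _ _ fun j hj => le_sparseProduct_basisVec l hj
    rw [nsmul_eq_mul] at h3
    linarith
  have hup : ∀ S : Finset (Fin d),
      ∑ j ∈ Sᶜ, (outputLaw A (sparseProduct l S) (basisVec j)).toReal ≤ α := fun S => by
    have h := sum_le_sum_add_tvDist (outputLaw A (sparseProduct l S)) (sparseProduct l S)
      (Sᶜ.image basisVec)
    rw [Finset.sum_image basisVec_injective.injOn, Finset.sum_image basisVec_injective.injOn,
      Finset.sum_eq_zero (s := Sᶜ) (f := fun j => (sparseProduct l S (basisVec j)).toReal)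
        fun j hj => sparseProduct_basisVec_of_notMem l (Finset.mem_compl.mp hj), zero_add] at h
    exact h.trans (hacc _ (hmem S))
  have ha : 0 ≤ (1 + l.1 * (Real.exp ε - 1)) ^ n :=
    pow_nonneg (by nlinarith [l.2.1, Real.one_le_exp hε]) n
  obtain ⟨hc1, hc2⟩ := sum_card_finset d
  have main : (2 : ℝ) ^ d * (d / 2 * (l.1 * (1 - d * l.1)) - α) ≤ 2 ^ d *
      ((1 + l.1 * (Real.exp ε - 1)) ^ n * (α + d / 2 * (n * (l.1 * δ)))) := by
    calc (2 : ℝ) ^ d * (d / 2 * (l.1 * (1 - d * l.1)) - α)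
        = ∑ S : Finset (Fin d), (S.card * (l.1 * (1 - d * l.1)) - α) := by
          rw [Finset.sum_sub_distrib, ← Finset.sum_mul, hc1]
          simp
          ring
      _ ≤ ∑ S : Finset (Fin d), ∑ j ∈ S,
            (outputLaw A (sparseProduct l S) (basisVec j)).toReal :=
          Finset.sum_le_sum fun S _ => hlow S
      _ = ∑ S : Finset (Fin d), ∑ j ∈ Sᶜ,
            (outputLaw A (sparseProduct l (insert j S)) (basisVec j)).toReal :=
          sum_mem_eq_sum_insert fun S j => (outputLaw A (sparseProduct l S) (basisVec j)).toReal
      _ ≤ ∑ S : Finset (Fin d), ∑ j ∈ Sᶜ, (1 + l.1 * (Real.exp ε - 1)) ^ n *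
            ((outputLaw A (sparseProduct l S) (basisVec j)).toReal + n * (l.1 * δ)) :=
          Finset.sum_le_sum fun S _ => Finset.sum_le_sum fun j hj =>
            outputLaw_sparseProduct_insert_le hε hδ hA l (Finset.mem_compl.mp hj) _
      _ ≤ ∑ S : Finset (Fin d), (1 + l.1 * (Real.exp ε - 1)) ^ n *
            (α + Sᶜ.card * (n * (l.1 * δ))) := by
          refine Finset.sum_le_sum fun S _ => ?_
          rw [← Finset.mul_sum, Finset.sum_add_distrib, Finset.sum_const, nsmul_eq_mul]
          exact mul_le_mul_of_nonneg_left (add_le_add_left (hup S) _) ha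
      _ = _ := by
          rw [← Finset.mul_sum, Finset.sum_add_distrib, ← Finset.sum_mul, hc2]
          simp
          ring
  exact le_of_mul_le_mul_left main (by positivity)

/-! ### Choice of the bias and conclusion -/

theorem one_add_mul_exp_sub_one_pow_le {l ε : ℝ} (hl : 0 ≤ l) (hε : 0 ≤ ε) (hε1 : ε ≤ 1) (n : ℕ) :
    (1 + l * (Real.exp ε - 1)) ^ n ≤ Real.exp (2 * (n * l * ε)) := by
  have h1 : Real.exp ε - 1 ≤ 2 * ε := by
    have := Real.abs_exp_sub_one_le (x := ε) (by rwa [abs_of_nonneg hε])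
    rw [abs_of_nonneg hε] at this
    exact (le_abs_self _).trans this
  have h2 : 1 + l * (Real.exp ε - 1) ≤ Real.exp (2 * l * ε) :=
    le_trans (by nlinarith) (Real.add_one_le_exp (2 * l * ε))
  calc (1 + l * (Real.exp ε - 1)) ^ n ≤ Real.exp (2 * l * ε) ^ n :=
        pow_le_pow_left₀ (by nlinarith [Real.one_le_exp hε]) h2 n
    _ = Real.exp (2 * (n * l * ε)) := by rw [← Real.exp_nat_mul]; ring_nf

end PrivSampling

theorem theorem1p7 :
    ∃ α₀ c : ℝ, 0 < α₀ ∧ 0 < c ∧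
      ∀ α : ℝ, 0 < α → α ≤ α₀ →
      ∀ d n : ℕ, 1 ≤ n →
      ∀ ε δ : ℝ, 0 < ε → ε ≤ 1 → 0 ≤ δ → δ ≤ 1 / (5000 * (n : ℝ)) →
        (∃ A : (Fin n → (Fin d → Bool)) → PMF (Fin d → Bool),
          PrivSampling.IsDP ε δ A ∧
          PrivSampling.IsAccurateOnClass α A (PrivSampling.productBernoulli d)) →
        c * ((d : ℝ) / (α * ε)) ≤ (n : ℝ) := by
  refine ⟨1 / 100, 1 / 100, by norm_num, by norm_num, ?_⟩
  rintro α hα hα' d n hn ε δ hε hε1 hδ hδn ⟨A, hA, hacc⟩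
  by_contra! hlt
  have hn0 : (0 : ℝ) < n := by exact_mod_cast hn
  obtain rfl | hd := Nat.eq_zero_or_pos d
  · simp at hlt
    linarith
  have hd1 : (1 : ℝ) ≤ d := by exact_mod_cast hd
  -- With this bias a random support carries expected signal about `d l / 2 = 5α`, well above the
  -- error `α`, while `d l = 10α ≤ 1/10` keeps the loss factor `1 - d l` near `1`.
  have hl0 : 0 ≤ 10 * α / d := by positivity
  have hl1 : 10 * α / d ≤ 1 := by rw [div_le_one (by linarith)]; linarith
  have hdl : (d : ℝ) * (10 * α / d) = 10 * α := by field_simp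
  have h := PrivSampling.sparse_accuracy_privacy_tradeoff hε.le hδ hA hacc ⟨10 * α / d, hl0, hl1⟩
  have hpow := PrivSampling.one_add_mul_exp_sub_one_pow_le hl0 hε.le hε1 n
  have hexp : Real.exp (2 * (n * (10 * α / d) * ε)) ≤ 3 := by
    have h1 : (n : ℝ) * (10 * α / d) * ε ≤ 1 / 10 := by
      have h2 : (n : ℝ) * (α * ε) < 1 / 100 * d := by
        rwa [← mul_div_assoc, lt_div_iff₀ (by positivity)] at hlt
      have h3 : (n : ℝ) * (10 * α / d) * ε = 10 * (n * (α * ε)) / d := by field_simp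
      rw [h3, div_le_iff₀ (by linarith)]
      linarith
    exact (Real.exp_le_exp.mpr (by linarith)).trans Real.exp_one_lt_three.le
  have hnδ : n * δ ≤ 1 / 5000 := by
    rw [le_div_iff₀ (by positivity)] at hδn
    linarith
  dsimp only at h
  have hadd : α + (d : ℝ) / 2 * (n * (10 * α / d * δ)) ≤ α * (1 + 1 / 1000) := by
    have : (d : ℝ) / 2 * (n * (10 * α / d * δ)) = 5 * α * (n * δ) := by field_simp; ring
    rw [this]
    nlinarith
  have hL : (d : ℝ) / 2 * (10 * α / d * (1 - d * (10 * α / d))) - α =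
      5 * α * (1 - 10 * α) - α := by
    rw [hdl]; field_simp; ring
  have hR := mul_le_mul (hpow.trans hexp) hadd (by positivity) (by norm_num)
  rw [hL] at h
  -- The left side is at least `3.5 α` and the right side at most `3.003 α`.
  nlinarith
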